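/- Let $(\mathcal S,\mathcal A,T,r,\gamma)$ be a discounted Markov decision process with finite non-empty state and action spaces $\mathcal S,\mathcal A$, transition kernel $T(s'\mid s,a)$, real-valued reward function $r(s,a)$ and discount factor $\gamma\in(0,1)$, and let $\pi(a\mid s)$ be a stationary behavior policy. Let $\mathcal X$ be the set of possible transitions $x=(s,a,s')$, i.e. those triples with $T(s'\mid s,a)>0$, and let $P$ be the transition matrix on $\mathcal X$ of the data stream $x_k=(s_k,a_k,s_{k+1})$ generated under $\pi$: $$P\big((s,a,s'),(u,b,u')\big)=\mathbf 1\{u=s'\}\,\pi(b\mid u)\,T(u'\mid u,b).$$ Suppose that $P$ is irreducible and aperiodic with stationary distribution $\mu_{\mathcal X}$, and that $(x_k)_{k\ge0}$ is a Markov chain with transition matrix $P$ and $x_0\sim\mu_{\mathcal X}$. Put $$\beta=1-(1-\gamma)\min_{(s,a)\in\mathcal S\times\mathcal A}\mu_{\mathcal S}(s,a),$$ where $\mu_{\mathcal S}(s,a)=\sum_{s'}\mu_{\mathcal X}(s,a,s')$ is the stationary distribution of $(s_k,a_k)_{k\ge0}$, and, for $\delta>0$, $$t_\delta=\min\Big\{k\ge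 0:\ \max_{x\in\mathcal X}\|P^k(x,\cdot)-\mu_{\mathcal X}\|_{TV}\le\delta\Big\}.$$ For a stepsize $\alpha>0$ let $(q^{[1]}_k)_{k\ge 0}$ and $(q^{[2]}_k)_{k\ge0}$ be two runs of Q-learning driven by the same data stream: for $i=1,2$, $$q^{[i]}_{k+1}(s_k,a_k)=q^{[i]}_k(s_k,a_k)+\alpha\Big(r(s_k,a_k)+\gamma\max_{v\in\mathcal A}q^{[i]}_k(s_{k+1},v)-q^{[i]}_k(s_k,a_k)\Big),$$ and $q^{[i]}_{k+1}(s,a)=q^{[i]}_k(s,a)$ for $(s,a)\ne(s_k,a_k)$. The random initial vectors $q_0^{[1]},q_0^{[2]}\in\mathbb R^{\mathcal S\times\mathcal A}$ may depend on each other and on $x_0$, but $(q_0^{[1]},q_0^{[2]})$ is independent of $(x_k)_{k\ge1}$ given $x_0$. Let $w_k=q^{[1]}_k-q^{[2]}_k$. There is a universal constant $c_0>0$ (independent of the decision process, the policy, the stepsize and the initial vectors) such that, whenever $t_\alpha\ge1$ and $$\alpha\,t_\alpha\le c_0\,\frac{(1-\beta)^2}{\log(|\mathcal S||\mathcal A|)},$$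 one has, for all $k\ge t_\alpha$, $$\mathbb E\big[\|w_k\|_\infty^2\big]\le 12\,\mathbb E\big[\|w_0\|_\infty^2\big]\Big(1-\frac{(1-\beta)\alpha}{2}\Big)^{k-t_\alpha}.$$ (Both expectations are in $[0,\infty]$. The condition $t_\alpha\ge1$ forces $|\mathcal S||\mathcal A|\ge2$, so the logarithm is positive.) -/

import Mathlib

open MeasureTheory ProbabilityTheory
open scoped ENNReal

noncomputable section

/-! ### Finite Markov chains -/

/-- A stationary probability distribution of the transition matrix `P`. -/
def IsStationaryDist {X : Type*} [Fintype X] (P : Matrix X X ℝ) (μ : X → ℝ) : Prop :=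
  μ ∈ stdSimplex ℝ X ∧ Matrix.vecMul μ P = μ

/-- Every state has period one: the greatest common divisor of its return times is `1`. -/
def IsAperiodic {X : Type*} [Fintype X] [DecidableEq X] (P : Matrix X X ℝ) : Prop :=
  ∀ x : X, ∀ d : ℕ, (∀ n : ℕ, 0 < n → 0 < (P ^ n) x x → d ∣ n) → d = 1

/-- Total variation distance between two distributions on a finite set. -/
def tvDist {X : Type*} [Fintype X] (μ ν : X → ℝ) : ℝ :=
  (1 / 2) * ∑ x, |μ x - ν x|

/-- `t_δ`: the first `k` with `max_x ‖P^k(x, ·) - μ‖_TV ≤ δ`. -/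
def mixingTime {X : Type*} [Fintype X] [DecidableEq X]
    (P : Matrix X X ℝ) (μ : X → ℝ) (δ : ℝ) : ℕ :=
  sInf {k : ℕ | ∀ x : X, tvDist ((P ^ k) x) μ ≤ δ}

/-- `x₀, x₁, …` is a time-homogeneous Markov chain with initial distribution `μ` and transition
matrix `P` under the probability `Pr`. -/
def IsMarkovChain {X : Type*} {Ω : Type*} [MeasurableSpace Ω] (Pr : Measure Ω)
    (P : Matrix X X ℝ) (μ : X → ℝ) (x : ℕ → Ω → X) : Prop :=
  ∀ (n : ℕ) (y : ℕ → X),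
    Pr {ω | ∀ i ≤ n, x i ω = y i} =
      ENNReal.ofReal (μ (y 0) * ∏ i ∈ Finset.range n, P (y i) (y (i + 1)))

/-! ### Discounted Markov decision processes -/

/-- A discounted Markov decision process on the state space `S` and action space `A`. -/
structure MDP (S A : Type*) [Fintype S] [Fintype A] where
  /-- `T s a s'` is the probability of moving to `s'` from `s` under action `a`. -/
  T : S → A → S → ℝ
  /-- reward function -/
  r : S → A → ℝ
  /-- discount factor -/
  γ : ℝ
  T_mem : ∀ s a, T s a ∈ stdSimplex ℝ S
  γ_pos : 0 < γ
  γ_lt_one : γ < 1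

/-- A stationary policy: `prob s a` is the probability of taking action `a` in state `s`. -/
structure Policy (S A : Type*) [Fintype A] where
  prob : S → A → ℝ
  prob_mem : ∀ s, prob s ∈ stdSimplex ℝ A

namespace MDP

variable {S A : Type*} [Fintype S] [Fintype A]

/-- The state space of the data stream: triples `x = (s, a, s')` that can occur as a transition.
(It is all of `S × A × S` exactly when every transition probability is positive; a triple of
probability zero cannot belong to an irreducible chain.) -/
def Transition (M : MDP S A) : Type _ :=
  {x : S × A × S // 0 < M.T x.1 x.2.1 x.2.2}

variable (M : MDP S A)

instance : Fintype M.Transition :=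
  inferInstanceAs (Fintype {x : S × A × S // 0 < M.T x.1 x.2.1 x.2.2})

instance [DecidableEq S] [DecidableEq A] : DecidableEq M.Transition :=
  inferInstanceAs (DecidableEq {x : S × A × S // 0 < M.T x.1 x.2.1 x.2.2})

/-- The discrete σ-algebra. -/
instance : MeasurableSpace M.Transition := ⊤

variable {M}

/-- The state `s` of `x = (s, a, s')`. -/
def Transition.state (x : M.Transition) : S := x.1.1

/-- The action `a` of `x = (s, a, s')`. -/
def Transition.action (x : M.Transition) : A := x.1.2.1

/-- The next state `s'` of `x = (s, a, s')`. -/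
def Transition.next (x : M.Transition) : S := x.1.2.2

variable (M)

/-- The transition matrix of the data stream `x_k = (s_k, a_k, s_{k+1})` generated by the
process under the behavior policy `π`. -/
def dataMatrix [DecidableEq S] (π : Policy S A) : Matrix M.Transition M.Transition ℝ :=
  fun x y =>
    if y.state = x.next then π.prob y.state y.action * M.T y.state y.action y.next else 0

/-- The transition matrix of the state-action chain `(s_k, a_k)` under the policy `π`. -/
def stateActionMatrix (π : Policy S A) : Matrix (S × A) (S × A) ℝ :=
  fun z z' => M.T z.1 z.2 z'.1 * π.prob z'.1 z'.2

/-- The law of `(s, a)` when `(s, a, s')` has law `μ`. -/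
def stateActionLaw [DecidableEq S] [DecidableEq A] (μ : M.Transition → ℝ) : S × A → ℝ :=
  fun z => ∑ x : M.Transition, if (x.state, x.action) = z then μ x else 0

/-- A sum weighted by `T` over possible transitions is the sum over all triples. -/
theorem sum_transition (g : S × A × S → ℝ) :
    ∑ y : M.Transition, g y.1 * M.T y.state y.action y.next
      = ∑ s, ∑ a, ∑ s', g (s, a, s') * M.T s a s' := by
  classical
  have h1 : ∑ y : M.Transition, g y.1 * M.T y.state y.action y.next
      = ∑ y ∈ Finset.univ.filter (fun y : S × A × S => 0 < M.T y.1 y.2.1 y.2.2),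
          g y * M.T y.1 y.2.1 y.2.2 :=
    (Finset.sum_subtype (p := fun y : S × A × S => 0 < M.T y.1 y.2.1 y.2.2) _
      (by simp) (fun y => g y * M.T y.1 y.2.1 y.2.2)).symm
  rw [h1, Finset.sum_filter_of_ne, Fintype.sum_prod_type]
  · simp only [Fintype.sum_prod_type]
  · intro y _ hy
    exact lt_of_le_of_ne ((M.T_mem y.1 y.2.1).1 y.2.2) (fun h => hy (by rw [← h, mul_zero]))

/-- The state-action law of a stationary data stream is a stationary distribution of the
state-action chain. -/
theorem isStationaryDist_stateActionLaw [DecidableEq S] [DecidableEq A] (π : Policy S A)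
    (μ : M.Transition → ℝ) (h : IsStationaryDist (M.dataMatrix π) μ) :
    IsStationaryDist (M.stateActionMatrix π) (M.stateActionLaw μ) := by
  obtain ⟨⟨h0, h1⟩, h2⟩ := h
  have law : ∀ f : S × A → ℝ, ∑ z, M.stateActionLaw μ z * f z
      = ∑ x : M.Transition, μ x * f (x.state, x.action) := by
    intro f
    simp only [stateActionLaw, Finset.sum_mul]
    rw [Finset.sum_comm]
    simp [ite_mul]
  -- stationarity, tested against functions
  have test : ∀ g : S × A × S → ℝ, ∑ y : M.Transition, μ y * g y.1
      = ∑ x : M.Transition, μ x *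
          ∑ a, ∑ s', g (x.next, a, s') * π.prob x.next a * M.T x.next a s' := by
    intro g
    have e : ∀ y, μ y = ∑ x : M.Transition, μ x * M.dataMatrix π x y := by
      intro y; exact (congrFun h2 y).symm
    calc ∑ y : M.Transition, μ y * g y.1
        = ∑ y : M.Transition, ∑ x : M.Transition, μ x * M.dataMatrix π x y * g y.1 := by
          refine Finset.sum_congr rfl fun y _ => ?_
          rw [← Finset.sum_mul, ← e y]
      _ = ∑ x : M.Transition, μ x * ∑ y : M.Transition,
            (g y.1 * (if y.1.1 = x.next then π.prob y.1.1 y.1.2.1 else 0))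
              * M.T y.state y.action y.next := by
          rw [Finset.sum_comm]
          refine Finset.sum_congr rfl fun x _ => ?_
          rw [Finset.mul_sum]
          refine Finset.sum_congr rfl fun y _ => ?_
          by_cases hy : y.state = x.next
          · rw [dataMatrix, if_pos hy, if_pos (show y.1.1 = x.next from hy)]
            simp only [Transition.state, Transition.action]
            ring
          · rw [dataMatrix, if_neg hy, if_neg (show ¬ y.1.1 = x.next from hy)]
            ring
      _ = _ := by
          refine Finset.sum_congr rfl fun x _ => ?_
          rw [M.sum_transition (fun y => g y * (if y.1 = x.next then π.prob y.1 y.2.1 else 0))]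
          congr 1
          rw [Finset.sum_eq_single x.next]
          · simp
          · intro s _ hs
            simp [hs]
          · simp
  have next : ∀ s', ∑ x : M.Transition, μ x * M.T x.state x.action s'
      = ∑ x : M.Transition, μ x * (if x.next = s' then 1 else 0) := by
    intro s'
    have t1 := test (fun y => M.T y.1 y.2.1 s')
    have t2 := test (fun y => if y.2.2 = s' then 1 else 0)
    simp only [Transition.state, Transition.action]
    rw [t1]
    refine Eq.trans ?_ t2.symm
    refine Finset.sum_congr rfl fun x _ => ?_
    congr 1
    refine Finset.sum_congr rfl fun a _ => ?_
    dsimp only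
    rw [← Finset.mul_sum, (M.T_mem x.next a).2]
    simp [ite_mul, mul_comm]
  refine ⟨⟨fun z => Finset.sum_nonneg fun x _ => ?_, ?_⟩, ?_⟩
  · split_ifs
    exacts [h0 x, le_rfl]
  · have := law (fun _ => 1)
    simpa [h1] using this
  · funext z
    have e1 : Matrix.vecMul (M.stateActionLaw μ) (M.stateActionMatrix π) z
        = (∑ x : M.Transition, μ x * M.T x.state x.action z.1) * π.prob z.1 z.2 := by
      have := law (fun w => M.T w.1 w.2 z.1 * π.prob z.1 z.2)
      refine Eq.trans this ?_
      rw [Finset.sum_mul]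
      exact Finset.sum_congr rfl fun x _ => by ring
    have e2 : M.stateActionLaw μ z = ∑ y : M.Transition, μ y *
        (if (y.1.1, y.1.2.1) = z then 1 else 0) := by
      refine Finset.sum_congr rfl fun y _ => ?_
      by_cases hy : (y.state, y.action) = z
      · rw [if_pos hy, if_pos (show (y.1.1, y.1.2.1) = z from hy), mul_one]
      · rw [if_neg hy, if_neg (show ¬ (y.1.1, y.1.2.1) = z from hy), mul_zero]
    rw [e1, e2, test (fun y => if (y.1, y.2.1) = z then 1 else 0), next, Finset.sum_mul]
    refine Finset.sum_congr rfl fun x _ => ?_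
    rw [mul_assoc]
    congr 1
    obtain ⟨s, a⟩ := z
    rw [Finset.sum_eq_single a]
    · by_cases hx : x.next = s
      · simp [hx, ← Finset.mul_sum, (M.T_mem s a).2]
      · simp [hx]
    · intro b _ hb
      simp [hb]
    · simp

/-- `β = 1 - (1 - γ) min_{(s,a)} μ_S(s, a)`, with `μ_S` the law of the state-action pair under
the stationary distribution `μ` of the data stream. -/
def contractionFactor [DecidableEq S] [DecidableEq A] [Nonempty S] [Nonempty A]
    (μ : M.Transition → ℝ) : ℝ :=
  1 - (1 - M.γ) * Finset.univ.inf' Finset.univ_nonempty (M.stateActionLaw μ)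

/-- The empirical Bellman operator `F(x, q)`: for `x = (s, a, s')` it equals
`r(s, a) + γ max_v q(s', v) - q(s, a)` at `(s, a)` and vanishes elsewhere. -/
def empiricalBellman [DecidableEq S] [DecidableEq A] [Nonempty A]
    (x : M.Transition) (q : S × A → ℝ) : S × A → ℝ :=
  fun z => if z = (x.state, x.action) then
      M.r x.state x.action
        + M.γ * Finset.univ.sup' Finset.univ_nonempty (fun v : A => q (x.next, v))
        - q (x.state, x.action)
    else 0

/-- Q-learning with constant stepsize `α`, data `x` and initial value `q₀`:
`q_{k+1} = q_k + α F(x_k, q_k)`. -/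
def qLearning [DecidableEq S] [DecidableEq A] [Nonempty A] (α : ℝ)
    (x : ℕ → M.Transition) (q₀ : S × A → ℝ) : ℕ → S × A → ℝ
  | 0 => q₀
  | k + 1 => qLearning α x q₀ k + α • M.empiricalBellman (x k) (qLearning α x q₀ k)

end MDP

end

/-!
Let `w` be the difference of the two runs. Each step is nonexpansive in the sup norm, and `N` visits
to `z` bring `|w z|` below `(γ + (1 - γ) (1 - α) ^ N) ‖w₀‖`. Cut time into blocks of length `n`
close to `1 / (10 α)`. If every pair is visited about as often in a block as the stationary law
predicts, then `‖w‖` contracts over that block by a factor `1 - κ` with `κ` of order `(1 - β) α n`.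
The total squared relative deviation `D` of the visit counts has a small mean from every initial
state, because the covariance of two visits is small once they are `t_α` steps apart. The factor
`1 - κ (1 - D)` covers good and bad blocks alike: it is at least `1 - κ`, and at least `1` when
`1 ≤ D`. As `‖w‖` never increases, `‖w‖²` contracts by the same factor, and by the Markov property
the mean of the product of these factors over `B` blocks is at most `(1 - (1 - β) α / 2) ^ (n B)`.
The initial difference comes out of the expectation after conditioning on `x₀`, given which it is
independent of the rest of the stream.
-/

/-! ### Path expectations -/

section PathExpectation

variable {X : Type*}

/-- The path that starts at `y` and continues along `ξ`. -/
def pathCons (y : X) (ξ : ℕ → X) : ℕ → X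
  | 0 => y
  | i + 1 => ξ i

/-- The path `ξ` seen from time `m` on. -/
def pathShift (m : ℕ) (ξ : ℕ → X) : ℕ → X := fun i => ξ (m + i)

@[simp] theorem pathCons_zero (y : X) (ξ : ℕ → X) : pathCons y ξ 0 = y := rfl

@[simp] theorem pathCons_succ (y : X) (ξ : ℕ → X) (i : ℕ) : pathCons y ξ (i + 1) = ξ i := rfl

theorem pathCons_head_tail (ξ : ℕ → X) : pathCons (ξ 0) (fun i => ξ (i + 1)) = ξ := by
  funext i
  cases i <;> rfl

theorem pathShift_zero (ξ : ℕ → X) : pathShift 0 ξ = ξ := by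
  funext i
  rw [pathShift, zero_add]

theorem pathShift_succ_pathCons (m : ℕ) (y : X) (ξ : ℕ → X) :
    pathShift (m + 1) (pathCons y ξ) = pathShift m ξ := by
  funext i
  rw [pathShift, pathShift, Nat.add_right_comm, pathCons_succ]

theorem dependsOn_comp_pathCons {β : Type*} {G : (ℕ → X) → β} {m : ℕ}
    (hG : DependsOn G (Set.Iic (m + 1))) (y : X) :
    DependsOn (fun ξ => G (pathCons y ξ)) (Set.Iic m) := by
  intro ξ ζ h
  apply hG
  rintro (_ | i) hi
  · rfl
  · exact h i (Nat.le_of_succ_le_succ hi)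

theorem dependsOn_comp_apply {β : Type*} (h : X → β) {j m : ℕ} (hj : j ≤ m) :
    DependsOn (fun ξ : ℕ → X => h (ξ j)) (Set.Iic m) :=
  fun _ _ e => congrArg h (e j hj)

variable [Fintype X]

/-- The expectation of `G (ξ₀, …, ξₙ, ξₙ, …)` for a chain `ξ` with transition matrix `P`
started at `y`: freezing the path at time `n` keeps every expectation a finite sum. -/
def pathExp (P : Matrix X X ℝ) : ℕ → ((ℕ → X) → ℝ) → X → ℝ
  | 0, G, y => G fun _ => y
  | n + 1, G, y => ∑ y', P y y' * pathExp P n (fun ξ => G (pathCons y ξ)) y'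

variable {P : Matrix X X ℝ}

theorem pathExp_add (n : ℕ) (G H : (ℕ → X) → ℝ) (y : X) :
    pathExp P n (fun ξ => G ξ + H ξ) y = pathExp P n G y + pathExp P n H y := by
  induction n generalizing G H y with
  | zero => rfl
  | succ n ih => simp only [pathExp, ih, mul_add, Finset.sum_add_distrib]

theorem pathExp_const_mul (n : ℕ) (c : ℝ) (G : (ℕ → X) → ℝ) (y : X) :
    pathExp P n (fun ξ => c * G ξ) y = c * pathExp P n G y := by
  induction n generalizing G y with
  | zero => rfl
  | succ n ih => simp only [pathExp, ih, Finset.mul_sum, mul_left_comm]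

theorem pathExp_zero_fun (n : ℕ) (y : X) : pathExp P n (fun _ => 0) y = 0 := by
  simpa only [zero_mul] using pathExp_const_mul (P := P) n 0 (fun _ => 0) y

theorem pathExp_sum {ι : Type*} (s : Finset ι) (n : ℕ) (G : ι → (ℕ → X) → ℝ) (y : X) :
    pathExp P n (fun ξ => ∑ i ∈ s, G i ξ) y = ∑ i ∈ s, pathExp P n (G i) y := by
  classical
  induction s using Finset.induction_on with
  | empty => exact pathExp_zero_fun n y
  | insert a s ha ih => simp only [Finset.sum_insert ha, pathExp_add, ih]

theorem pathExp_mul_of_dependsOn_zero (n : ℕ) {g : (ℕ → X) → ℝ} (hg : DependsOn g (Set.Iic 0))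
    (H : (ℕ → X) → ℝ) (y : X) :
    pathExp P n (fun ξ => g ξ * H ξ) y = g (fun _ => y) * pathExp P n H y := by
  cases n with
  | zero => rfl
  | succ n =>
    have hcons : ∀ ξ, g (pathCons y ξ) = g fun _ => y := fun ξ =>
      hg fun i hi => by rw [Nat.le_zero.1 hi, pathCons_zero]
    simp only [pathExp, hcons, pathExp_const_mul, Finset.mul_sum, mul_left_comm]

/-- The Markov property at time `m`. -/
theorem pathExp_mul_pathShift (m n : ℕ) {g : (ℕ → X) → ℝ} (hg : DependsOn g (Set.Iic m))
    (H : (ℕ → X) → ℝ) (y : X) :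
    pathExp P (m + n) (fun ξ => g ξ * H (pathShift m ξ)) y
      = pathExp P m (fun ξ => g ξ * pathExp P n H (ξ m)) y := by
  induction m generalizing g y with
  | zero =>
    simp only [pathShift_zero, zero_add]
    exact pathExp_mul_of_dependsOn_zero n hg H y
  | succ m ih =>
    rw [Nat.add_right_comm]
    simp only [pathExp, pathShift_succ_pathCons, pathCons_succ,
      ih (dependsOn_comp_pathCons hg y)]

variable [DecidableEq X]

theorem pathExp_mono (hP : P ∈ Matrix.rowStochastic ℝ X) (n : ℕ) {G H : (ℕ → X) → ℝ}
    (h : ∀ ξ, G ξ ≤ H ξ) (y : X) : pathExp P n G y ≤ pathExp P n H y := by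
  induction n generalizing G H y with
  | zero => exact h _
  | succ n ih =>
    exact Finset.sum_le_sum fun y' _ =>
      mul_le_mul_of_nonneg_left (ih (fun ξ => h _) y') (Matrix.nonneg_of_mem_rowStochastic hP)

theorem pathExp_nonneg (hP : P ∈ Matrix.rowStochastic ℝ X) (n : ℕ) {G : (ℕ → X) → ℝ}
    (h : ∀ ξ, 0 ≤ G ξ) (y : X) : 0 ≤ pathExp P n G y :=
  (pathExp_zero_fun n y).ge.trans (pathExp_mono hP n h y)

theorem pathExp_const (hP : P ∈ Matrix.rowStochastic ℝ X) (n : ℕ) (c : ℝ) (y : X) :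
    pathExp P n (fun _ => c) y = c := by
  induction n generalizing y with
  | zero => rfl
  | succ n ih =>
    simp only [pathExp, ih, ← Finset.sum_mul, Matrix.sum_row_of_mem_rowStochastic hP, one_mul]

theorem pathExp_apply (hP : P ∈ Matrix.rowStochastic ℝ X) {j n : ℕ} (hj : j ≤ n)
    (h : X → ℝ) (y : X) : pathExp P n (fun ξ => h (ξ j)) y = ((P ^ j).mulVec h) y := by
  induction n generalizing j y with
  | zero => rw [Nat.le_zero.1 hj, pow_zero, Matrix.one_mulVec, pathExp]
  | succ n ih =>
    cases j with
    | zero =>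
      simp only [pathExp, pathCons_zero, pathExp_const hP, ← Finset.sum_mul,
        Matrix.sum_row_of_mem_rowStochastic hP, one_mul, pow_zero, Matrix.one_mulVec]
    | succ j =>
      simp only [pathExp, pathCons_succ, ih (Nat.le_of_succ_le_succ hj)]
      rw [pow_succ', ← Matrix.mulVec_mulVec]
      rfl

theorem pathExp_apply_mul_apply (hP : P ∈ Matrix.rowStochastic ℝ X) {i j n : ℕ} (hij : i ≤ j)
    (hj : j ≤ n) (g h : X → ℝ) (y : X) :
    pathExp P n (fun ξ => g (ξ i) * h (ξ j)) y
      = ((P ^ i).mulVec fun u => g u * ((P ^ (j - i)).mulVec h) u) y := by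
  have markov := pathExp_mul_pathShift (P := P) i (n - i) (dependsOn_comp_apply g le_rfl)
    (fun ξ => h (ξ (j - i))) y
  simp only [pathShift, Nat.add_sub_cancel' hij, Nat.add_sub_cancel' (hij.trans hj),
    pathExp_apply hP (Nat.sub_le_sub_right hj i)] at markov
  rw [markov]
  exact pathExp_apply hP le_rfl (fun u => g u * ((P ^ (j - i)).mulVec h) u) y

end PathExpectation

/-! ### Second moments of additive functionals under mixing -/

section Mixing

variable {X : Type*} [Fintype X] {P : Matrix X X ℝ} {μ h : X → ℝ} {δ e : ℝ} {t : ℕ}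

theorem abs_mulVec_le_of_tvDist_le {y : X} (hh : ∀ u, |h u| ≤ 1) (hμ : ∑ u, μ u * h u = 0)
    (hP : tvDist (P y) μ ≤ δ) : |(P.mulVec h) y| ≤ 2 * δ := by
  have centred : (P.mulVec h) y = ∑ u, (P y u - μ u) * h u := by
    simp only [Matrix.mulVec, dotProduct, sub_mul, Finset.sum_sub_distrib, hμ, sub_zero]
  calc |(P.mulVec h) y| ≤ ∑ u, |(P y u - μ u) * h u| :=
        centred ▸ Finset.abs_sum_le_sum_abs _ _
    _ ≤ ∑ u, |P y u - μ u| := Finset.sum_le_sum fun u _ => by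
        rw [abs_mul]
        exact mul_le_of_le_one_right (abs_nonneg _) (hh u)
    _ = 2 * tvDist (P y) μ := by rw [tvDist]; ring
    _ ≤ 2 * δ := by gcongr

variable [DecidableEq X]

theorem mulVec_mono_of_mem_rowStochastic (hP : P ∈ Matrix.rowStochastic ℝ X) {f g : X → ℝ}
    (hfg : ∀ u, f u ≤ g u) (y : X) : (P.mulVec f) y ≤ (P.mulVec g) y :=
  Finset.sum_le_sum fun u _ =>
    mul_le_mul_of_nonneg_left (hfg u) (Matrix.nonneg_of_mem_rowStochastic hP)

theorem mulVec_const_of_mem_rowStochastic (hP : P ∈ Matrix.rowStochastic ℝ X) (c : ℝ) (y : X) :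
    (P.mulVec fun _ => c) y = c := by
  simp only [Matrix.mulVec, dotProduct, ← Finset.sum_mul, Matrix.sum_row_of_mem_rowStochastic hP,
    one_mul]

theorem abs_mulVec_le_of_mem_rowStochastic (hP : P ∈ Matrix.rowStochastic ℝ X) {f : X → ℝ}
    {C : ℝ} (hf : ∀ u, |f u| ≤ C) (y : X) : |(P.mulVec f) y| ≤ C := by
  have lower := mulVec_mono_of_mem_rowStochastic hP (fun u => (abs_le.1 (hf u)).1) y
  have upper := mulVec_mono_of_mem_rowStochastic hP (fun u => (abs_le.1 (hf u)).2) y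
  rw [mulVec_const_of_mem_rowStochastic hP] at lower upper
  exact abs_le.2 ⟨lower, upper⟩

theorem abs_pow_mulVec_le_of_tvDist_le (hP : P ∈ Matrix.rowStochastic ℝ X)
    (hmix : ∀ y, tvDist ((P ^ t) y) μ ≤ δ) (hh : ∀ u, |h u| ≤ 1) (hμ : ∑ u, μ u * h u = 0)
    {i : ℕ} (hi : t ≤ i) (y : X) : |((P ^ i).mulVec h) y| ≤ 2 * δ := by
  rw [← Nat.sub_add_cancel hi, pow_add, ← Matrix.mulVec_mulVec]
  exact abs_mulVec_le_of_mem_rowStochastic (pow_mem hP _)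
    (fun u => abs_mulVec_le_of_tvDist_le hh hμ (hmix u)) y

theorem pow_mulVec_abs_le_of_tvDist_le (hP : P ∈ Matrix.rowStochastic ℝ X)
    (hmix : ∀ y, tvDist ((P ^ t) y) μ ≤ δ) (hh : ∀ u, |h u| ≤ 1) (hμ : ∑ u, μ u * h u = 0)
    (hδe : δ ≤ e) (he : ∀ u, -e ≤ h u) {i : ℕ} (hi : t ≤ i) (y : X) :
    ((P ^ i).mulVec fun u => |h u|) y ≤ 4 * e := by
  have mixed := abs_pow_mulVec_le_of_tvDist_le hP hmix hh hμ hi y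
  have he0 : 0 ≤ e := by linarith [abs_nonneg (((P ^ i).mulVec h) y)]
  have habs : ∀ u, |h u| ≤ h u + 2 * e := fun u => abs_le'.2 ⟨by linarith, by linarith [he u]⟩
  have hPi : P ^ i ∈ Matrix.rowStochastic ℝ X := pow_mem hP i
  calc ((P ^ i).mulVec fun u => |h u|) y
      ≤ ((P ^ i).mulVec (h + fun _ => 2 * e)) y := mulVec_mono_of_mem_rowStochastic hPi habs y
    _ = ((P ^ i).mulVec h) y + 2 * e := by
        rw [Matrix.mulVec_add, Pi.add_apply, mulVec_const_of_mem_rowStochastic hPi]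
    _ ≤ 4 * e := by linarith [le_abs_self (((P ^ i).mulVec h) y)]

theorem pathExp_apply_mul_apply_le (hP : P ∈ Matrix.rowStochastic ℝ X) {g : X → ℝ} {c : ℝ}
    {i j n : ℕ} (hij : i ≤ j) (hj : j ≤ n) (hc : ∀ u, |((P ^ (j - i)).mulVec h) u| ≤ c) (y : X) :
    pathExp P n (fun ξ => g (ξ i) * h (ξ j)) y ≤ c * ((P ^ i).mulVec fun u => |g u|) y := by
  have hmul : ∀ u, g u * ((P ^ (j - i)).mulVec h) u ≤ (c • fun u => |g u|) u := fun u =>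
    calc g u * ((P ^ (j - i)).mulVec h) u ≤ |g u| * |((P ^ (j - i)).mulVec h) u| := by
          rw [← abs_mul]
          exact le_abs_self _
      _ ≤ |g u| * c := mul_le_mul_of_nonneg_left (hc u) (abs_nonneg _)
      _ = c * |g u| := mul_comm _ _
  rw [pathExp_apply_mul_apply hP hij hj]
  refine (mulVec_mono_of_mem_rowStochastic (pow_mem hP i) hmul y).trans_eq ?_
  rw [Matrix.mulVec_smul, Pi.smul_apply, smul_eq_mul]

theorem pathExp_apply_mul_apply_le_of_tvDist_le (hP : P ∈ Matrix.rowStochastic ℝ X)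
    (hmix : ∀ y, tvDist ((P ^ t) y) μ ≤ δ) (hh : ∀ u, |h u| ≤ 1) (hμ : ∑ u, μ u * h u = 0)
    (hδe : δ ≤ e) (he : ∀ u, -e ≤ h u) {i j n : ℕ} (hti : t ≤ i) (htj : t ≤ j) (hi : i ≤ n)
    (hj : j ≤ n) (y : X) :
    pathExp P n (fun ξ => h (ξ i) * h (ξ j)) y
      ≤ 8 * δ * e + if i < j + t ∧ j < i + t then 4 * e else 0 := by
  wlog hij : i ≤ j generalizing i j
  · simpa only [mul_comm, and_comm] using this htj hti hj hi (Nat.le_of_not_le hij)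
  have hδ0 : 0 ≤ δ := by
    linarith [(abs_nonneg _).trans (abs_pow_mulVec_le_of_tvDist_le hP hmix hh hμ le_rfl y)]
  have hcount := pow_mulVec_abs_le_of_tvDist_le hP hmix hh hμ hδe he hti y
  by_cases hnear : j < i + t
  · have hle := pathExp_apply_mul_apply_le hP (g := h) hij hj
      (abs_mulVec_le_of_mem_rowStochastic (pow_mem hP _) hh) y
    rw [if_pos ⟨by lia, hnear⟩]
    nlinarith
  · have hle := pathExp_apply_mul_apply_le hP (g := h) hij hj
      (abs_pow_mulVec_le_of_tvDist_le hP hmix hh hμ (by lia)) y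
    rw [if_neg fun H => hnear H.2]
    nlinarith

/-- Only the `O((n - t) t)` pairs of times closer than `t` contribute terms of order `e`;
the other pairs are decorrelated up to the mixing error `δ`. -/
theorem pathExp_sq_sum_Ico_le_of_tvDist_le (hP : P ∈ Matrix.rowStochastic ℝ X)
    (hmix : ∀ y, tvDist ((P ^ t) y) μ ≤ δ) (hh : ∀ u, |h u| ≤ 1) (hμ : ∑ u, μ u * h u = 0)
    (hδe : δ ≤ e) (he : ∀ u, -e ≤ h u) (n : ℕ) (y : X) :
    pathExp P n (fun ξ => (∑ i ∈ Finset.Ico t n, h (ξ i)) ^ 2) y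
      ≤ 8 * e * ((n - t : ℕ) * t + (n - t : ℕ) ^ 2 * δ) := by
  have he0 : 0 ≤ e := by
    linarith [(abs_nonneg _).trans (abs_pow_mulVec_le_of_tvDist_le hP hmix hh hμ le_rfl y)]
  have hnear : ∀ i, ((Finset.Ico t n).filter fun j => i < j + t ∧ j < i + t).card ≤ 2 * t := by
    intro i
    calc _ ≤ (Finset.Ico (i + 1 - t) (i + t)).card := Finset.card_le_card fun j hj => by
          have := (Finset.mem_filter.1 hj).2
          exact Finset.mem_Ico.2 (by lia)
      _ ≤ 2 * t := by rw [Nat.card_Ico]; lia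
  have hrow : ∀ i ∈ Finset.Ico t n,
      ∑ j ∈ Finset.Ico t n, pathExp P n (fun ξ => h (ξ i) * h (ξ j)) y
        ≤ (n - t : ℕ) * (8 * δ * e) + 2 * t * (4 * e) := by
    intro i hi
    rw [Finset.mem_Ico] at hi
    calc _ ≤ ∑ j ∈ Finset.Ico t n, (8 * δ * e + if i < j + t ∧ j < i + t then 4 * e else 0) :=
          Finset.sum_le_sum fun j hj => by
            rw [Finset.mem_Ico] at hj
            exact pathExp_apply_mul_apply_le_of_tvDist_le hP hmix hh hμ hδe he hi.1 hj.1
              hi.2.le hj.2.le y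
      _ = (n - t : ℕ) * (8 * δ * e)
          + ((Finset.Ico t n).filter fun j => i < j + t ∧ j < i + t).card * (4 * e) := by
          rw [Finset.sum_add_distrib, ← Finset.sum_filter]
          simp only [Finset.sum_const, Nat.card_Ico, nsmul_eq_mul]
      _ ≤ _ := by gcongr; exact_mod_cast hnear i
  simp only [sq (Finset.sum _ _), Finset.sum_mul_sum, pathExp_sum]
  refine (Finset.sum_le_sum hrow).trans_eq ?_
  rw [Finset.sum_const, Nat.card_Ico, nsmul_eq_mul]
  ring

end Mixing

/-! ### Conditioning on the initial state -/

section InitialData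

variable {X Ω : Type*} {P : Matrix X X ℝ} {μ : X → ℝ} {x : ℕ → Ω → X}

theorem pathCons_tail_eq_of_mem_preimage {ω : Ω} {y : X} (hω : ω ∈ x 0 ⁻¹' {y}) :
    (pathCons y fun k => x (k + 1) ω) = fun k => x k ω := by
  rw [← pathCons_head_tail fun k => x k ω, show x 0 ω = y from hω]

variable [MeasurableSpace Ω] {Pr : Measure Ω}

theorem setLIntegral_mul_le_of_indepFun_cond {s : Set Ω} (hs : Pr s ≠ ∞) {U V : Ω → ℝ≥0∞}
    (hU : Measurable U) (hV : Measurable V) (hUV : IndepFun U V (Pr[|s])) {c : ℝ≥0∞}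
    (hc : ∫⁻ ω in s, V ω ∂Pr ≤ Pr s * c) :
    ∫⁻ ω in s, U ω * V ω ∂Pr ≤ (∫⁻ ω in s, U ω ∂Pr) * c := by
  by_cases h0 : Pr s = 0
  · rw [setLIntegral_measure_zero s _ h0]
    exact zero_le
  have hrestrict : Pr.restrict s = Pr s • Pr[|s] := by
    rw [ProbabilityTheory.cond, smul_smul, ENNReal.mul_inv_cancel h0 hs, one_smul]
  simp only [hrestrict, lintegral_smul_measure, smul_eq_mul] at hc ⊢
  rw [lintegral_mul_eq_lintegral_mul_lintegral_of_indepFun'' hU.aemeasurable hV.aemeasurable hUV,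
    mul_assoc]
  gcongr
  exact (ENNReal.mul_le_mul_iff_right h0 hs).1 hc

theorem IsMarkovChain.measure_preimage_zero (hM : IsMarkovChain Pr P μ x) (y : X) :
    Pr (x 0 ⁻¹' {y}) = ENNReal.ofReal (μ y) := by
  have hset : x 0 ⁻¹' {y} = {ω | ∀ i ≤ 0, x i ω = y} := by
    ext ω
    simp only [Set.mem_preimage, Set.mem_singleton_iff, Nat.le_zero, Set.mem_ofPred_eq,
      forall_eq]
  rw [hset, hM 0 fun _ => y, Finset.range_zero, Finset.prod_empty, mul_one]

variable [MeasurableSpace X]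

theorem lintegral_eq_sum_setLIntegral_preimage [Fintype X] [MeasurableSingletonClass X]
    {Y : Ω → X} (hY : Measurable Y) (F : Ω → ℝ≥0∞) :
    ∫⁻ ω, F ω ∂Pr = ∑ y, ∫⁻ ω in Y ⁻¹' {y}, F ω ∂Pr := by
  have hdisj : Pairwise (Function.onFun Disjoint fun y => Y ⁻¹' {y}) := fun u v huv =>
    (Set.disjoint_singleton.2 huv).preimage Y
  rw [← tsum_fintype (L := .unconditional X),
    ← lintegral_iUnion (fun y => hY (measurableSet_singleton y)) hdisj, ← Set.preimage_iUnion,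
    Set.iUnion_of_singleton, Set.preimage_univ, Measure.restrict_univ]

theorem measurable_pathCons (y : X) : Measurable (pathCons y) :=
  measurable_pi_iff.2 fun k => match k with
    | 0 => measurable_const
    | k + 1 => measurable_pi_apply k

namespace IsMarkovChain

variable [MeasurableSingletonClass X]

/-- Neither the restricted measure nor the new initial law is normalised. -/
theorem tail (hM : IsMarkovChain Pr P μ x) (hx : Measurable (x 0)) (y : X) :
    IsMarkovChain (Pr.restrict (x 0 ⁻¹' {y})) P (fun v => μ y * P y v) fun k => x (k + 1) := by
  intro n ξ
  have hset : {ω | ∀ i ≤ n, x (i + 1) ω = ξ i} ∩ x 0 ⁻¹' {y}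
      = {ω | ∀ i ≤ n + 1, x i ω = pathCons y ξ i} := by
    ext ω
    constructor
    · rintro ⟨hsucc, hzero⟩ (_ | i) hi
      exacts [hzero, hsucc i (Nat.le_of_succ_le_succ hi)]
    · exact fun h => ⟨fun i hi => h (i + 1) (Nat.succ_le_succ hi), h 0 (Nat.zero_le _)⟩
  rw [Measure.restrict_apply' (hx (measurableSet_singleton y)), hset, hM (n + 1) (pathCons y ξ),
    Finset.prod_range_succ', mul_assoc]
  simp only [pathCons_zero, pathCons_succ, zero_add, mul_comm]

variable [Fintype X] [DecidableEq X]

theorem setLIntegral_eq_pathExp (hM : IsMarkovChain Pr P μ x) (hx : ∀ k, Measurable (x k))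
    (hP : P ∈ Matrix.rowStochastic ℝ X) {n : ℕ} {G : (ℕ → X) → ℝ} (hG0 : ∀ ξ, 0 ≤ G ξ)
    (hG : DependsOn G (Set.Iic n)) (y : X) :
    ∫⁻ ω in x 0 ⁻¹' {y}, ENNReal.ofReal (G fun k => x k ω) ∂Pr
      = ENNReal.ofReal (μ y) * ENNReal.ofReal (pathExp P n G y) := by
  have hmeas : MeasurableSet (x 0 ⁻¹' {y}) := hx 0 (measurableSet_singleton y)
  induction n generalizing Pr μ x G y with
  | zero =>
    have hconst : ∀ ω ∈ x 0 ⁻¹' {y}, ENNReal.ofReal (G fun k => x k ω)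
        = ENNReal.ofReal (G fun _ => y) := fun ω hω =>
      congrArg ENNReal.ofReal (hG fun i hi => by rw [Nat.le_zero.1 hi]; exact hω)
    rw [setLIntegral_congr_fun hmeas hconst, setLIntegral_const, hM.measure_preimage_zero,
      mul_comm, pathExp]
  | succ n ih =>
    have hcons : ∀ ω ∈ x 0 ⁻¹' {y}, ENNReal.ofReal (G fun k => x k ω)
        = ENNReal.ofReal (G (pathCons y fun k => x (k + 1) ω)) := fun ω hω => by
      rw [pathCons_tail_eq_of_mem_preimage hω]
    have hstep : ∀ v, ENNReal.ofReal (μ y * P y v)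
          * ENNReal.ofReal (pathExp P n (fun ξ => G (pathCons y ξ)) v)
        = ENNReal.ofReal (μ y)
          * ENNReal.ofReal (P y v * pathExp P n (fun ξ => G (pathCons y ξ)) v) := fun v => by
      rw [ENNReal.ofReal_mul' (Matrix.nonneg_of_mem_rowStochastic hP),
        ENNReal.ofReal_mul (Matrix.nonneg_of_mem_rowStochastic hP), mul_assoc]
    rw [setLIntegral_congr_fun hmeas hcons, lintegral_eq_sum_setLIntegral_preimage (hx 1), pathExp,
      ENNReal.ofReal_sum_of_nonneg fun v _ => mul_nonneg
        (Matrix.nonneg_of_mem_rowStochastic hP) (pathExp_nonneg hP n (fun ξ => hG0 _) v),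
      Finset.mul_sum]
    exact Finset.sum_congr rfl fun v _ => (ih (hM.tail (hx 0) y) (fun k => hx (k + 1))
      (fun ξ => hG0 _) (dependsOn_comp_pathCons hG y) v (hx 1 (measurableSet_singleton v))).trans
        (hstep v)

theorem lintegral_mul_le (hM : IsMarkovChain Pr P μ x) (hx : ∀ k, Measurable (x k))
    (hP : P ∈ Matrix.rowStochastic ℝ X) {U : Ω → ℝ≥0∞} (hU : Measurable U)
    (hind : ∀ y, IndepFun U (fun ω k => x (k + 1) ω) (Pr[|x 0 ⁻¹' {y}]))
    {G : (ℕ → X) → ℝ} (hGm : Measurable G) (hG0 : ∀ ξ, 0 ≤ G ξ) {n : ℕ}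
    (hG : DependsOn G (Set.Iic n)) {θ : ℝ} (hθ : ∀ y, pathExp P n G y ≤ θ) :
    ∫⁻ ω, U ω * ENNReal.ofReal (G fun k => x k ω) ∂Pr
      ≤ (∫⁻ ω, U ω ∂Pr) * ENNReal.ofReal θ := by
  rw [lintegral_eq_sum_setLIntegral_preimage (hx 0),
    lintegral_eq_sum_setLIntegral_preimage (hx 0) U, Finset.sum_mul]
  refine Finset.sum_le_sum fun y _ => ?_
  have hmeas : MeasurableSet (x 0 ⁻¹' {y}) := hx 0 (measurableSet_singleton y)
  have hGcons : Measurable fun ξ => ENNReal.ofReal (G (pathCons y ξ)) :=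
    (hGm.comp (measurable_pathCons y)).ennreal_ofReal
  have hcons : ∀ ω ∈ x 0 ⁻¹' {y}, G (fun k => x k ω) = G (pathCons y fun k => x (k + 1) ω) :=
    fun ω hω => by rw [pathCons_tail_eq_of_mem_preimage hω]
  rw [setLIntegral_congr_fun hmeas fun ω hω =>
    congrArg (fun r => U ω * ENNReal.ofReal r) (hcons ω hω)]
  refine setLIntegral_mul_le_of_indepFun_cond ?_ hU
    (hGcons.comp (measurable_pi_iff.2 fun k => hx (k + 1))) ((hind y).comp measurable_id hGcons) ?_
  · rw [hM.measure_preimage_zero]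
    exact ENNReal.ofReal_ne_top
  · rw [Function.comp_def,
      ← setLIntegral_congr_fun hmeas fun ω hω => congrArg ENNReal.ofReal (hcons ω hω),
      hM.setLIntegral_eq_pathExp hx hP hG0 hG, hM.measure_preimage_zero]
    gcongr
    exact hθ y

end IsMarkovChain

end InitialData

/-! ### Products over consecutive blocks -/

section BlockProduct

variable {X : Type*}

/-- The product of the values of the path functional `Φ` along the first `B` consecutive blocks of
length `n` of a path. -/
def blockProduct (Φ : (ℕ → X) → ℝ) (n : ℕ) : ℕ → (ℕ → X) → ℝ
  | 0, _ => 1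
  | B + 1, ξ => Φ ξ * blockProduct Φ n B (pathShift n ξ)

variable {Φ : (ℕ → X) → ℝ} {n : ℕ}

theorem blockProduct_nonneg (hΦ : ∀ ξ, 0 ≤ Φ ξ) (B : ℕ) (ξ : ℕ → X) :
    0 ≤ blockProduct Φ n B ξ := by
  induction B generalizing ξ with
  | zero => exact zero_le_one
  | succ B ih => exact mul_nonneg (hΦ ξ) (ih _)

theorem dependsOn_blockProduct (hΦ : DependsOn Φ (Set.Iic n)) (B : ℕ) :
    DependsOn (blockProduct Φ n B) (Set.Iic (B * n)) := by
  induction B with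
  | zero => exact fun _ _ _ => rfl
  | succ B ih =>
    intro ξ ζ h
    have hn : (B + 1) * n = n + B * n := by ring
    have hfirst : Φ ξ = Φ ζ := hΦ fun i hi =>
      h i (hn ▸ (Set.mem_Iic.1 hi).trans (Nat.le_add_right n _))
    have hrest : blockProduct Φ n B (pathShift n ξ) = blockProduct Φ n B (pathShift n ζ) :=
      ih fun i hi => h (n + i) (hn ▸ Nat.add_le_add_left (Set.mem_Iic.1 hi) n)
    rw [blockProduct, blockProduct, hfirst, hrest]

theorem measurable_pathShift [MeasurableSpace X] (m : ℕ) :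
    Measurable (pathShift m : (ℕ → X) → ℕ → X) :=
  measurable_pi_iff.2 fun i => measurable_pi_apply (m + i)

theorem measurable_blockProduct [MeasurableSpace X] (hΦ : Measurable Φ) (B : ℕ) :
    Measurable (blockProduct Φ n B) := by
  induction B with
  | zero => exact measurable_const
  | succ B ih => exact hΦ.mul (ih.comp (measurable_pathShift n))

theorem pathExp_blockProduct_le [Fintype X] [DecidableEq X] {P : Matrix X X ℝ}
    (hP : P ∈ Matrix.rowStochastic ℝ X) (hΦ0 : ∀ ξ, 0 ≤ Φ ξ) (hΦ : DependsOn Φ (Set.Iic n))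
    {θ : ℝ} (hθ : ∀ y, pathExp P n Φ y ≤ θ) (B : ℕ) (y : X) :
    pathExp P (B * n) (blockProduct Φ n B) y ≤ θ ^ B := by
  have hθ0 : 0 ≤ θ := (pathExp_nonneg hP n hΦ0 y).trans (hθ y)
  induction B generalizing y with
  | zero => exact (pathExp_const hP _ 1 y).le
  | succ B ih =>
    calc pathExp P ((B + 1) * n) (blockProduct Φ n (B + 1)) y
        = pathExp P n (fun ξ => Φ ξ * pathExp P (B * n) (blockProduct Φ n B) (ξ n)) y := by
          rw [← pathExp_mul_pathShift n (B * n) hΦ, add_one_mul, add_comm]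
          rfl
      _ ≤ pathExp P n (fun ξ => θ ^ B * Φ ξ) y := pathExp_mono hP n (fun ξ => by
          rw [mul_comm]
          exact mul_le_mul_of_nonneg_right (ih _) (hΦ0 ξ)) y
      _ = θ ^ B * pathExp P n Φ y := pathExp_const_mul _ _ _ _
      _ ≤ θ ^ B * θ := mul_le_mul_of_nonneg_left (hθ y) (pow_nonneg hθ0 B)
      _ = θ ^ (B + 1) := (pow_succ θ B).symm

end BlockProduct

/-! ### Pathwise contraction of Q-learning -/

theorem abs_sup'_sub_sup'_le {ι : Type*} {s : Finset ι} (hs : s.Nonempty) {f g : ι → ℝ} {C : ℝ}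
    (h : ∀ i ∈ s, |f i - g i| ≤ C) : |s.sup' hs f - s.sup' hs g| ≤ C := by
  have upper : s.sup' hs f ≤ s.sup' hs g + C := Finset.sup'_le hs f fun i hi => by
    linarith [(abs_le.1 (h i hi)).2, Finset.le_sup' g hi]
  have lower : s.sup' hs g ≤ s.sup' hs f + C := Finset.sup'_le hs g fun i hi => by
    linarith [(abs_le.1 (h i hi)).1, Finset.le_sup' f hi]
  exact abs_sub_le_iff.2 ⟨by linarith, by linarith⟩

theorem one_sub_pow_le_inv_one_add {α a : ℝ} (hα : α ≤ 1) (ha : 0 ≤ a) {N : ℕ}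
    (haN : a ≤ α * N) : (1 - α) ^ N ≤ (1 + a)⁻¹ := by
  calc (1 - α) ^ N ≤ Real.exp (-α) ^ N :=
        pow_le_pow_left₀ (sub_nonneg.2 hα) (Real.one_sub_le_exp_neg α) N
    _ = Real.exp (-(α * N)) := by rw [← Real.exp_nat_mul]; ring_nf
    _ ≤ Real.exp (-a) := Real.exp_le_exp.2 (neg_le_neg haN)
    _ = (Real.exp a)⁻¹ := Real.exp_neg a
    _ ≤ (1 + a)⁻¹ := by
        gcongr
        linarith [Real.add_one_le_exp a]

namespace MDP

section Pathwise

variable {S A : Type*} [Fintype S] [Fintype A] [DecidableEq S] [DecidableEq A] {M : MDP S A}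

/-- The indicator of the transitions out of the state-action pair `z`. -/
def visit (z : S × A) (x : M.Transition) : ℝ :=
  if (x.state, x.action) = z then 1 else 0

/-- The number of visits to the state-action pair `z` during `[0, n)`. -/
def visitCount (ξ : ℕ → M.Transition) (z : S × A) (n : ℕ) : ℕ :=
  ((Finset.range n).filter fun i => ((ξ i).state, (ξ i).action) = z).card

theorem visitCount_succ (ξ : ℕ → M.Transition) (z : S × A) (n : ℕ) :
    visitCount ξ z (n + 1)
      = visitCount ξ z n + if ((ξ n).state, (ξ n).action) = z then 1 else 0 := by
  simp only [visitCount, Finset.card_filter, Finset.sum_range_succ]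

theorem sum_visit_le_visitCount (ξ : ℕ → M.Transition) (z : S × A) (t n : ℕ) :
    ∑ i ∈ Finset.Ico t n, visit z (ξ i) ≤ visitCount ξ z n := by
  simp only [visit, Finset.sum_boole, visitCount]
  exact_mod_cast Finset.card_le_card (Finset.filter_subset_filter _ fun i hi =>
    Finset.mem_range.2 (Finset.mem_Ico.1 hi).2)

/-- The sum over all pairs `z` of the squared relative deviation of the number of visits to `z`
during `[t, n)` from `(n - t) ν z`, scaled so that a value below `1` makes every relative deviation
less than `1 / 4`. -/
noncomputable def visitDeviation (ν : S × A → ℝ) (t n : ℕ) (ξ : ℕ → M.Transition) : ℝ :=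
  ∑ z, (4 / ((n - t : ℕ) * ν z) * ∑ i ∈ Finset.Ico t n, (visit z (ξ i) - ν z)) ^ 2

theorem visitDeviation_nonneg (ν : S × A → ℝ) (t n : ℕ) (ξ : ℕ → M.Transition) :
    0 ≤ visitDeviation ν t n ξ :=
  Finset.sum_nonneg fun _ _ => sq_nonneg _

theorem le_visitCount_of_visitDeviation_lt_one {ν : S × A → ℝ} (hν : ∀ z, 0 < ν z) {t n : ℕ}
    (htn : t < n) {ξ : ℕ → M.Transition} (h : visitDeviation ν t n ξ < 1) (z : S × A) :
    3 / 4 * ((n - t : ℕ) * ν z) ≤ visitCount ξ z n := by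
  have hpos : 0 < (n - t : ℕ) * ν z :=
    mul_pos (Nat.cast_pos.2 (Nat.sub_pos_of_lt htn)) (hν z)
  have hdev : (4 / ((n - t : ℕ) * ν z) * ∑ i ∈ Finset.Ico t n, (visit z (ξ i) - ν z)) ^ 2 < 1 :=
    (Finset.single_le_sum (f := fun z => (4 / ((n - t : ℕ) * ν z) *
      ∑ i ∈ Finset.Ico t n, (visit z (ξ i) - ν z)) ^ 2) (fun _ _ => sq_nonneg _)
      (Finset.mem_univ z)).trans_lt h
  have hlower := (abs_lt.1 ((sq_lt_one_iff_abs_lt_one _).1 hdev)).1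
  rw [div_mul_eq_mul_div, lt_div_iff₀ hpos, Finset.sum_sub_distrib, Finset.sum_const,
    Nat.card_Ico, nsmul_eq_mul] at hlower
  linarith [sum_visit_le_visitCount ξ z t n]

/-- The bound `1 - κ (1 - D)` for the contraction over a block of length `n`, with `D` the visit
deviation. It is affine in `D`, so its mean is explicit, and it is at least `1` on the bad event
`1 ≤ D`, where only nonexpansiveness is available. -/
noncomputable def blockFactor (κ : ℝ) (ν : S × A → ℝ) (t n : ℕ) (ξ : ℕ → M.Transition) : ℝ :=
  1 - κ * (1 - visitDeviation ν t n ξ)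

theorem blockFactor_nonneg {κ : ℝ} (h0 : 0 ≤ κ) (h1 : κ ≤ 1) (ν : S × A → ℝ) (t n : ℕ)
    (ξ : ℕ → M.Transition) : 0 ≤ blockFactor κ ν t n ξ := by
  rw [blockFactor]
  nlinarith [visitDeviation_nonneg ν t n ξ]

theorem dependsOn_blockFactor (κ : ℝ) (ν : S × A → ℝ) (t n : ℕ) :
    DependsOn (blockFactor (M := M) κ ν t n) (Set.Iic n) := by
  intro ξ ζ h
  have hsum : ∀ z, ∑ i ∈ Finset.Ico t n, (visit z (ξ i) - ν z)
      = ∑ i ∈ Finset.Ico t n, (visit z (ζ i) - ν z) := fun z =>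
    Finset.sum_congr rfl fun i hi => by rw [h i (Finset.mem_Ico.1 hi).2.le]
  simp only [blockFactor, visitDeviation, hsum]

theorem measurable_visit (z : S × A) : Measurable (visit (M := M) z) := measurable_from_top

theorem measurable_blockFactor (κ : ℝ) (ν : S × A → ℝ) (t n : ℕ) :
    Measurable (blockFactor (M := M) κ ν t n) := by
  have hvisit : ∀ z i, Measurable fun ξ : ℕ → M.Transition => visit z (ξ i) := fun z i =>
    (measurable_visit z).comp (measurable_pi_apply i)
  unfold blockFactor visitDeviation
  fun_prop

variable [Nonempty A] {α : ℝ}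

theorem qLearning_add (ξ : ℕ → M.Transition) (q : S × A → ℝ) (n k : ℕ) :
    M.qLearning α ξ q (n + k) = M.qLearning α (pathShift n ξ) (M.qLearning α ξ q n) k := by
  induction k with
  | zero => rfl
  | succ k ih => rw [← add_assoc, qLearning, qLearning, ih, pathShift]

theorem qLearning_succ_apply (ξ : ℕ → M.Transition) (q : S × A → ℝ) (k : ℕ) (z : S × A) :
    M.qLearning α ξ q (k + 1) z
      = if ((ξ k).state, (ξ k).action) = z then
          (1 - α) * M.qLearning α ξ q k z + α * (M.r z.1 z.2 + M.γ *
            Finset.univ.sup' Finset.univ_nonempty fun v => M.qLearning α ξ q k ((ξ k).next, v))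
        else M.qLearning α ξ q k z := by
  simp only [qLearning, empiricalBellman, Pi.add_apply, Pi.smul_apply, smul_eq_mul,
    eq_comm (a := z)]
  split_ifs with hz
  · subst hz
    ring
  · ring

theorem abs_qLearning_succ_sub_le (h0 : 0 ≤ α) (h1 : α ≤ 1) (ξ : ℕ → M.Transition)
    (q q' : S × A → ℝ) (k : ℕ) {C : ℝ}
    (hC : ∀ z, |M.qLearning α ξ q k z - M.qLearning α ξ q' k z| ≤ C) (z : S × A) :
    |M.qLearning α ξ q (k + 1) z - M.qLearning α ξ q' (k + 1) z|
      ≤ if ((ξ k).state, (ξ k).action) = z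
        then (1 - α) * |M.qLearning α ξ q k z - M.qLearning α ξ q' k z| + α * (M.γ * C)
        else |M.qLearning α ξ q k z - M.qLearning α ξ q' k z| := by
  rw [qLearning_succ_apply, qLearning_succ_apply]
  split_ifs
  · have hsup := abs_sup'_sub_sup'_le (Finset.univ_nonempty (α := A)) fun v _ =>
      hC ((ξ k).next, v)
    set s := Finset.univ.sup' Finset.univ_nonempty fun v => M.qLearning α ξ q k ((ξ k).next, v)
    set s' := Finset.univ.sup' Finset.univ_nonempty fun v => M.qLearning α ξ q' k ((ξ k).next, v)
    set u := M.qLearning α ξ q k z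
    set u' := M.qLearning α ξ q' k z
    have hγ := M.γ_pos.le
    have h1α := sub_nonneg.2 h1
    calc |(1 - α) * u + α * (M.r z.1 z.2 + M.γ * s) - ((1 - α) * u' + α * (M.r z.1 z.2 + M.γ * s'))|
        = |(1 - α) * (u - u') + α * (M.γ * (s - s'))| := by ring_nf
      _ ≤ |(1 - α) * (u - u')| + |α * (M.γ * (s - s'))| := abs_add_le _ _
      _ = (1 - α) * |u - u'| + α * (M.γ * |s - s'|) := by
          rw [abs_mul, abs_mul, abs_mul, abs_of_nonneg h0, abs_of_nonneg hγ, abs_of_nonneg h1α]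
      _ ≤ (1 - α) * |u - u'| + α * (M.γ * C) := by gcongr
  · exact le_rfl

theorem abs_qLearning_sub_le (h0 : 0 ≤ α) (h1 : α ≤ 1) (ξ : ℕ → M.Transition)
    (q q' : S × A → ℝ) (k : ℕ) (z : S × A) :
    |M.qLearning α ξ q k z - M.qLearning α ξ q' k z|
      ≤ (M.γ + (1 - M.γ) * (1 - α) ^ visitCount ξ z k) * ‖q - q'‖ := by
  induction k generalizing z with
  | zero =>
    simpa only [visitCount, Finset.range_zero, Finset.filter_empty, Finset.card_empty, pow_zero,
      mul_one, add_sub_cancel, one_mul, qLearning, Pi.sub_apply, Real.norm_eq_abs]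
      using norm_le_pi_norm (q - q') z
  | succ k ih =>
    have hC : ∀ z, |M.qLearning α ξ q k z - M.qLearning α ξ q' k z| ≤ ‖q - q'‖ := fun z => by
      refine (ih z).trans (mul_le_of_le_one_left (norm_nonneg _) ?_)
      have : (1 - α) ^ visitCount ξ z k ≤ 1 := pow_le_one₀ (sub_nonneg.2 h1) (by linarith)
      nlinarith [M.γ_lt_one]
    refine (abs_qLearning_succ_sub_le h0 h1 ξ q q' k hC z).trans ?_
    rw [visitCount_succ]
    split_ifs
    · rw [pow_succ]
      linarith [mul_le_mul_of_nonneg_left (ih z) (sub_nonneg.2 h1)]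
    · exact ih z

theorem norm_qLearning_sub_le_of_le_visitCount (h0 : 0 ≤ α) (h1 : α ≤ 1) (ξ : ℕ → M.Transition)
    (q q' : S × A → ℝ) (k : ℕ) {κ : ℝ} (hκ1 : κ ≤ 1)
    (hκ : ∀ z, κ ≤ (1 - M.γ) * (1 - (1 - α) ^ visitCount ξ z k)) :
    ‖M.qLearning α ξ q k - M.qLearning α ξ q' k‖ ≤ (1 - κ) * ‖q - q'‖ :=
  (pi_norm_le_iff_of_nonneg (mul_nonneg (sub_nonneg.2 hκ1) (norm_nonneg _))).2 fun z =>
    (abs_qLearning_sub_le h0 h1 ξ q q' k z).trans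
      (mul_le_mul_of_nonneg_right (by linarith [hκ z]) (norm_nonneg _))

theorem norm_qLearning_sub_le (h0 : 0 ≤ α) (h1 : α ≤ 1) (ξ : ℕ → M.Transition)
    (q q' : S × A → ℝ) (k : ℕ) : ‖M.qLearning α ξ q k - M.qLearning α ξ q' k‖ ≤ ‖q - q'‖ := by
  simpa only [sub_zero, one_mul] using
    norm_qLearning_sub_le_of_le_visitCount h0 h1 ξ q q' k zero_le_one fun z =>
      mul_nonneg (sub_nonneg.2 M.γ_lt_one.le)
        (sub_nonneg.2 (pow_le_one₀ (sub_nonneg.2 h1) (sub_le_self 1 h0)))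

theorem norm_qLearning_sub_le_mono (h0 : 0 ≤ α) (h1 : α ≤ 1) (ξ : ℕ → M.Transition)
    (q q' : S × A → ℝ) {m k : ℕ} (hmk : m ≤ k) :
    ‖M.qLearning α ξ q k - M.qLearning α ξ q' k‖
      ≤ ‖M.qLearning α ξ q m - M.qLearning α ξ q' m‖ := by
  rw [← Nat.add_sub_cancel' hmk, qLearning_add, qLearning_add]
  exact norm_qLearning_sub_le h0 h1 _ _ _ _

variable {κ : ℝ} {ν : S × A → ℝ} {t n : ℕ}

theorem norm_qLearning_sub_le_blockFactor (h0 : 0 ≤ α) (h1 : α ≤ 1) (hκ0 : 0 ≤ κ) (hκ1 : κ ≤ 1)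
    (hν : ∀ z, 0 < ν z) (htn : t < n) (hκ : ∀ z, ∀ N : ℕ, 3 / 4 * ((n - t : ℕ) * ν z) ≤ N →
      κ ≤ (1 - M.γ) * (1 - (1 - α) ^ N)) (ξ : ℕ → M.Transition) (q q' : S × A → ℝ) :
    ‖M.qLearning α ξ q n - M.qLearning α ξ q' n‖ ≤ blockFactor κ ν t n ξ * ‖q - q'‖ := by
  have hD0 := visitDeviation_nonneg ν t n ξ
  rcases lt_or_ge (visitDeviation ν t n ξ) 1 with hD | hD
  · refine (norm_qLearning_sub_le_of_le_visitCount h0 h1 ξ q q' n hκ1 fun z =>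
      hκ z _ (le_visitCount_of_visitDeviation_lt_one hν htn hD z)).trans ?_
    gcongr
    rw [blockFactor]
    nlinarith
  · refine (norm_qLearning_sub_le h0 h1 ξ q q' n).trans
      (le_mul_of_one_le_left (norm_nonneg _) ?_)
    rw [blockFactor]
    nlinarith

theorem norm_qLearning_sub_sq_le_blockProduct (h0 : 0 ≤ α) (h1 : α ≤ 1) (hκ0 : 0 ≤ κ)
    (hκ1 : κ ≤ 1) (hν : ∀ z, 0 < ν z) (htn : t < n)
    (hκ : ∀ z, ∀ N : ℕ, 3 / 4 * ((n - t : ℕ) * ν z) ≤ N → κ ≤ (1 - M.γ) * (1 - (1 - α) ^ N))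
    (B : ℕ) (ξ : ℕ → M.Transition) (q q' : S × A → ℝ) :
    ‖M.qLearning α ξ q (B * n) - M.qLearning α ξ q' (B * n)‖ ^ 2
      ≤ blockProduct (blockFactor κ ν t n) n B ξ * ‖q - q'‖ ^ 2 := by
  induction B generalizing ξ q q' with
  | zero => rw [zero_mul, qLearning, qLearning, blockProduct, one_mul]
  | succ B ih =>
    have hsq : ‖M.qLearning α ξ q n - M.qLearning α ξ q' n‖ ^ 2
        ≤ blockFactor κ ν t n ξ * ‖q - q'‖ ^ 2 := by
      rw [sq, sq, ← mul_assoc]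
      exact mul_le_mul (norm_qLearning_sub_le_blockFactor h0 h1 hκ0 hκ1 hν htn hκ ξ q q')
        (norm_qLearning_sub_le h0 h1 ξ q q' n) (norm_nonneg _)
        (mul_nonneg (blockFactor_nonneg hκ0 hκ1 ν t n ξ) (norm_nonneg _))
    rw [add_one_mul, add_comm, qLearning_add, qLearning_add, blockProduct,
      mul_comm (blockFactor κ ν t n ξ), mul_assoc]
    exact (ih _ _ _).trans (mul_le_mul_of_nonneg_left hsq
      (blockProduct_nonneg (blockFactor_nonneg hκ0 hκ1 ν t n) B _))

end Pathwise

end MDP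

/-! ### Mean contraction over a block -/

namespace MDP

section MeanContraction

variable {S A : Type*} [Fintype S] [Fintype A] {M : MDP S A}

instance : MeasurableSingletonClass M.Transition := ⟨fun _ => trivial⟩

variable [DecidableEq S]

theorem sum_dataMatrix (π : Policy S A) (x : M.Transition) : ∑ y, M.dataMatrix π x y = 1 := by
  have hweight : ∀ y : M.Transition, M.dataMatrix π x y
      = (if y.1.1 = x.next then π.prob y.1.1 y.1.2.1 else 0) * M.T y.state y.action y.next :=
    fun y => (ite_zero_mul _ _ _).symm
  calc ∑ y, M.dataMatrix π x y
      = ∑ s, ∑ a, ∑ s', (if s = x.next then π.prob s a else 0) * M.T s a s' := by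
        simp only [hweight]
        exact M.sum_transition fun y => if y.1 = x.next then π.prob y.1 y.2.1 else 0
    _ = ∑ s, ∑ a, if s = x.next then π.prob s a else 0 := by
        simp only [← Finset.mul_sum, (M.T_mem _ _).2, mul_one]
    _ = ∑ a, π.prob x.next a := by
        rw [Finset.sum_comm]
        simp only [Finset.sum_ite_eq', Finset.mem_univ, if_true]
    _ = 1 := (π.prob_mem x.next).2

variable [DecidableEq A]

theorem dataMatrix_mem_rowStochastic (π : Policy S A) :
    M.dataMatrix π ∈ Matrix.rowStochastic ℝ M.Transition := by
  refine Matrix.mem_rowStochastic_iff_sum.2 ⟨fun x y => ?_, sum_dataMatrix π⟩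
  rw [dataMatrix]
  split_ifs
  exacts [mul_nonneg ((π.prob_mem _).1 _) ((M.T_mem _ _).1 _), le_rfl]

theorem sum_mul_visit (μ : M.Transition → ℝ) (z : S × A) :
    ∑ u, μ u * visit z u = M.stateActionLaw μ z := by
  simp only [visit, stateActionLaw, mul_ite, mul_one, mul_zero]

theorem sum_stateActionLaw (μ : M.Transition → ℝ) :
    ∑ z, M.stateActionLaw μ z = ∑ u, μ u := by
  simp only [stateActionLaw]
  rw [Finset.sum_comm]
  simp only [Finset.sum_ite_eq, Finset.mem_univ, if_true]

variable {μ : M.Transition → ℝ} {p δ : ℝ} {t n : ℕ}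

theorem stateActionLaw_nonneg (hμ : μ ∈ stdSimplex ℝ M.Transition) (z : S × A) :
    0 ≤ M.stateActionLaw μ z :=
  Finset.sum_nonneg fun u _ => by
    split_ifs
    exacts [hμ.1 u, le_rfl]

theorem stateActionLaw_le_one (hμ : μ ∈ stdSimplex ℝ M.Transition)
    (z : S × A) : M.stateActionLaw μ z ≤ 1 :=
  calc M.stateActionLaw μ z ≤ ∑ u, μ u := Finset.sum_le_sum fun u _ => by
        split_ifs
        exacts [le_rfl, hμ.1 u]
    _ = 1 := hμ.2

theorem card_mul_le_one_of_le_stateActionLaw (hμ : μ ∈ stdSimplex ℝ M.Transition)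
    (hp : ∀ z, p ≤ M.stateActionLaw μ z) : (Fintype.card (S × A) : ℝ) * p ≤ 1 := by
  rw [← hμ.2, ← sum_stateActionLaw, ← nsmul_eq_mul]
  exact Finset.card_nsmul_le_sum Finset.univ (M.stateActionLaw μ) p fun z _ => hp z

theorem pathExp_sq_sum_visit_sub_le (π : Policy S A) (hμ : μ ∈ stdSimplex ℝ M.Transition)
    (hmix : ∀ y, tvDist ((M.dataMatrix π ^ t) y) μ ≤ δ) {z : S × A}
    (hδ : δ ≤ M.stateActionLaw μ z) (n : ℕ) (y : M.Transition) :
    pathExp (M.dataMatrix π) n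
        (fun ξ => (∑ i ∈ Finset.Ico t n, (visit z (ξ i) - M.stateActionLaw μ z)) ^ 2) y
      ≤ 8 * M.stateActionLaw μ z * ((n - t : ℕ) * t + (n - t : ℕ) ^ 2 * δ) := by
  have hν0 := stateActionLaw_nonneg hμ z
  have hν1 := stateActionLaw_le_one hμ z
  have hvisit : ∀ u : M.Transition, visit z u = 0 ∨ visit z u = 1 := fun u => by
    rw [visit]
    split_ifs <;> simp only [true_or, or_true]
  have centred : ∑ u, μ u * (visit z u - M.stateActionLaw μ z) = 0 := by
    simp only [mul_sub, Finset.sum_sub_distrib, ← Finset.sum_mul, sum_mul_visit, hμ.2, one_mul,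
      sub_self]
  refine pathExp_sq_sum_Ico_le_of_tvDist_le (dataMatrix_mem_rowStochastic π) hmix (fun u => ?_)
    centred hδ (fun u => ?_) n y
  · rw [abs_le]
    rcases hvisit u with h | h <;> rw [h] <;> constructor <;> linarith
  · rcases hvisit u with h | h <;> rw [h] <;> linarith

theorem pathExp_visitDeviation_le (π : Policy S A) (hμ : μ ∈ stdSimplex ℝ M.Transition)
    (hmix : ∀ y, tvDist ((M.dataMatrix π ^ t) y) μ ≤ δ) (hp0 : 0 < p)
    (hp : ∀ z, p ≤ M.stateActionLaw μ z) (hδ : δ ≤ p) (htn : t < n) (y : M.Transition) :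
    pathExp (M.dataMatrix π) n (visitDeviation (M.stateActionLaw μ) t n) y
      ≤ 128 / p ^ 2 * (t / (n - t : ℕ) + δ) := by
  have hm : (0 : ℝ) < (n - t : ℕ) := Nat.cast_pos.2 (Nat.sub_pos_of_lt htn)
  have hδ0 : 0 ≤ δ := le_trans (mul_nonneg (by norm_num) (Finset.sum_nonneg fun _ _ =>
    abs_nonneg _)) (hmix y)
  have hterm : ∀ z, pathExp (M.dataMatrix π) n (fun ξ => (4 / ((n - t : ℕ) *
      M.stateActionLaw μ z) * ∑ i ∈ Finset.Ico t n, (visit z (ξ i) - M.stateActionLaw μ z)) ^ 2) y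
      ≤ 128 / p * (t / (n - t : ℕ) + δ) := fun z => by
    have hz : 0 < M.stateActionLaw μ z := hp0.trans_le (hp z)
    simp only [mul_pow, pathExp_const_mul]
    calc _ ≤ (4 / ((n - t : ℕ) * M.stateActionLaw μ z)) ^ 2 *
          (8 * M.stateActionLaw μ z * ((n - t : ℕ) * t + (n - t : ℕ) ^ 2 * δ)) := by
          gcongr
          exact pathExp_sq_sum_visit_sub_le π hμ hmix (hδ.trans (hp z)) n y
      _ = 128 / M.stateActionLaw μ z * (t / (n - t : ℕ) + δ) := by
          field_simp
          ring
      _ ≤ 128 / p * (t / (n - t : ℕ) + δ) := by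
          gcongr
          exact hp z
  calc pathExp (M.dataMatrix π) n (visitDeviation (M.stateActionLaw μ) t n) y
      ≤ ∑ _z : S × A, 128 / p * (t / (n - t : ℕ) + δ) := by
        change pathExp _ n (fun ξ => ∑ z, _) y ≤ _
        rw [pathExp_sum]
        exact Finset.sum_le_sum fun z _ => hterm z
    _ = (Fintype.card (S × A) * p) * (128 / p ^ 2 * (t / (n - t : ℕ) + δ)) := by
        rw [Finset.sum_const, Finset.card_univ, nsmul_eq_mul]
        field_simp
    _ ≤ _ := mul_le_of_le_one_left (by positivity) (card_mul_le_one_of_le_stateActionLaw hμ hp)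

theorem pathExp_blockFactor (π : Policy S A) (κ : ℝ) (ν : S × A → ℝ) (t n : ℕ)
    (y : M.Transition) : pathExp (M.dataMatrix π) n (blockFactor κ ν t n) y
      = 1 - κ * (1 - pathExp (M.dataMatrix π) n (visitDeviation ν t n) y) := by
  have haffine : blockFactor (M := M) κ ν t n = fun ξ => (1 - κ) + κ * visitDeviation ν t n ξ := by
    funext ξ
    rw [blockFactor]
    ring
  rw [haffine, pathExp_add, pathExp_const (dataMatrix_mem_rowStochastic π), pathExp_const_mul]
  ring

theorem lintegral_qLearning_sub_sq_le [Nonempty A] (π : Policy S A) {α : ℝ} (h0 : 0 ≤ α)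
    (h1 : α ≤ 1) {κ θ : ℝ} (hκ0 : 0 ≤ κ) (hκ1 : κ ≤ 1) {ν : S × A → ℝ} (hν : ∀ z, 0 < ν z)
    (htn : t < n)
    (hκ : ∀ z, ∀ N : ℕ, 3 / 4 * ((n - t : ℕ) * ν z) ≤ N → κ ≤ (1 - M.γ) * (1 - (1 - α) ^ N))
    (hθ : ∀ y : M.Transition, pathExp (M.dataMatrix π) n (blockFactor κ ν t n) y ≤ θ)
    {Ω : Type*} [MeasurableSpace Ω] {Pr : Measure Ω} {ι : M.Transition → ℝ}
    {x : ℕ → Ω → M.Transition} {q₁ q₂ : Ω → S × A → ℝ} (hx : ∀ k, Measurable (x k))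
    (hM : IsMarkovChain Pr (M.dataMatrix π) ι x) (hq₁ : Measurable q₁) (hq₂ : Measurable q₂)
    (hind : ∀ y : M.Transition,
      IndepFun (fun ω => (q₁ ω, q₂ ω)) (fun ω k => x (k + 1) ω) (Pr[|x 0 ⁻¹' {y}]))
    {B k : ℕ} (hk : B * n ≤ k) :
    ∫⁻ ω, ‖M.qLearning α (fun j => x j ω) (q₁ ω) k
        - M.qLearning α (fun j => x j ω) (q₂ ω) k‖ₑ ^ 2 ∂Pr
      ≤ (∫⁻ ω, ‖q₁ ω - q₂ ω‖ₑ ^ 2 ∂Pr) * ENNReal.ofReal (θ ^ B) := by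
  have hU : Measurable fun q : (S × A → ℝ) × (S × A → ℝ) => ‖q.1 - q.2‖ₑ ^ 2 := by fun_prop
  have hΦ0 := blockFactor_nonneg (M := M) hκ0 hκ1 ν t n
  have hΦ := dependsOn_blockFactor (M := M) κ ν t n
  have hP := dataMatrix_mem_rowStochastic (M := M) π
  refine le_trans (lintegral_mono fun ω => ?_)
    (hM.lintegral_mul_le hx hP (hU.comp (hq₁.prodMk hq₂))
      (fun y => (hind y).comp hU measurable_id)
      (measurable_blockProduct (measurable_blockFactor κ ν t n) B) (blockProduct_nonneg hΦ0 B)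
      (dependsOn_blockProduct hΦ B) (pathExp_blockProduct_le hP hΦ0 hΦ hθ B))
  have hpath := (pow_le_pow_left₀ (norm_nonneg _)
    (norm_qLearning_sub_le_mono h0 h1 (fun j => x j ω) (q₁ ω) (q₂ ω) hk) 2).trans
    (norm_qLearning_sub_sq_le_blockProduct h0 h1 hκ0 hκ1 hν htn hκ B _ _ _)
  have hpath' := ENNReal.ofReal_le_ofReal hpath
  rwa [ENNReal.ofReal_mul (blockProduct_nonneg hΦ0 B _), ENNReal.ofReal_pow (norm_nonneg _),
    ENNReal.ofReal_pow (norm_nonneg _), ofReal_norm, ofReal_norm, mul_comm] at hpath'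

end MeanContraction

end MDP

/-! ### The block length -/

section BlockLength

variable {α p : ℝ} {t n : ℕ}

theorem exists_block_length (hα0 : 0 < α) (ht : 1 ≤ t) (hαt : α * t ≤ 1 / 1000) :
    ∃ n : ℕ, t < n ∧ α * n ≤ 11 / 100 ∧ α * t ≤ α * n / 100 ∧ 99 / 1000 ≤ α * (n - t : ℕ) := by
  have hα : α ≤ α * t := le_mul_of_one_le_right hα0.le (Nat.one_le_cast.2 ht)
  have hinv : α * (1 / (10 * α)) = 1 / 10 := by field_simp
  obtain ⟨n, hn⟩ : ∃ n, n = ⌈1 / (10 * α)⌉₊ := ⟨_, rfl⟩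
  have hlower : 1 / 10 ≤ α * n := by
    rw [← hinv, hn]
    exact mul_le_mul_of_nonneg_left (Nat.le_ceil _) hα0.le
  have hupper : α * n ≤ 11 / 100 := by
    have hceil : (⌈1 / (10 * α)⌉₊ : ℝ) < 1 / (10 * α) + 1 := Nat.ceil_lt_add_one (by positivity)
    rw [← hn] at hceil
    linarith [mul_le_mul_of_nonneg_left hceil.le hα0.le]
  have htn : t < n := by
    have : α * t < α * n := by linarith
    exact_mod_cast lt_of_mul_lt_mul_left this hα0.le
  refine ⟨n, htn, hupper, by linarith, ?_⟩
  rw [Nat.cast_sub htn.le]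
  linarith

theorem mul_le_one_sub_pow_of_le_visits (hα0 : 0 ≤ α) (hα1 : α ≤ 1) (hp0 : 0 ≤ p) (hp1 : p ≤ 1)
    (hn : α * n ≤ 11 / 100) (ht : α * t ≤ α * n / 100) (htn : t ≤ n) {ν : ℝ} (hν : p ≤ ν) {N : ℕ}
    (hN : 3 / 4 * ((n - t : ℕ) * ν) ≤ N) : 3 / 5 * (p * (α * n)) ≤ 1 - (1 - α) ^ N := by
  set s := p * (α * n)
  have hs0 : 0 ≤ s := by positivity
  have hs : s ≤ 11 / 100 := (mul_le_of_le_one_left (by positivity) hp1).trans hn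
  have hvisits : 297 / 400 * s ≤ α * N := by
    have hm : 99 / 100 * (α * n) ≤ α * (n - t : ℕ) := by
      rw [Nat.cast_sub htn]
      linarith
    calc 297 / 400 * s = 3 / 4 * (99 / 100 * (α * n) * p) := by ring
      _ ≤ 3 / 4 * (α * (n - t : ℕ) * ν) := by gcongr
      _ = α * (3 / 4 * ((n - t : ℕ) * ν)) := by ring
      _ ≤ α * N := mul_le_mul_of_nonneg_left hN hα0
  have hinv : (1 + 297 / 400 * s)⁻¹ ≤ 1 - 3 / 5 * s := by
    rw [inv_le_iff_one_le_mul₀ (by positivity)]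
    nlinarith
  linarith [one_sub_pow_le_inv_one_add hα1 (by positivity) hvisits]

theorem pow_pow_div_le {ρ C : ℝ} (h0 : 0 ≤ ρ) (h1 : ρ ≤ 1) (hn : 0 < n) (hC : 1 ≤ C * ρ ^ n)
    (k : ℕ) : (ρ ^ n) ^ (k / n) ≤ C * ρ ^ k := by
  have hC0 : 0 ≤ C := (pos_of_mul_pos_left (zero_lt_one.trans_le hC) (pow_nonneg h0 n)).le
  calc (ρ ^ n) ^ (k / n) ≤ (C * ρ ^ n) * (ρ ^ n) ^ (k / n) :=
        le_mul_of_one_le_left (by positivity) hC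
    _ = C * ρ ^ (n + n * (k / n)) := by rw [pow_add, pow_mul, mul_assoc]
    _ ≤ C * ρ ^ k := by
        refine mul_le_mul_of_nonneg_left (pow_le_pow_of_le_one h0 h1 ?_) hC0
        linarith [Nat.div_add_mod k n, Nat.mod_lt k hn]

end BlockLength

/-! ### The rate in terms of the stationary law -/

namespace MDP

section Rate

variable {S A : Type*} [Fintype S] [Fintype A] [DecidableEq S] [DecidableEq A] (M : MDP S A)

/-- The smallest probability of a state-action pair under the law `μ` of the transition; for the
stationary `μ` it is the quantity `min μ_S` that enters `β`. -/
noncomputable def minStateActionProb [Nonempty S] [Nonempty A] (μ : M.Transition → ℝ) : ℝ :=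
  Finset.univ.inf' Finset.univ_nonempty (M.stateActionLaw μ)

variable {M}

section Minimum

variable [Nonempty S] [Nonempty A] {μ : M.Transition → ℝ}

theorem minStateActionProb_le (z : S × A) : M.minStateActionProb μ ≤ M.stateActionLaw μ z :=
  Finset.inf'_le _ (Finset.mem_univ z)

theorem one_sub_contractionFactor :
    1 - M.contractionFactor μ = (1 - M.γ) * M.minStateActionProb μ :=
  sub_sub_cancel _ _

theorem minStateActionProb_mem_Icc (hμ : μ ∈ stdSimplex ℝ M.Transition) :
    M.minStateActionProb μ ∈ Set.Icc (0 : ℝ) 1 :=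
  ⟨Finset.le_inf' _ _ fun z _ => stateActionLaw_nonneg hμ z,
    (minStateActionProb_le (Classical.arbitrary _)).trans (stateActionLaw_le_one hμ _)⟩

theorem one_sub_contractionFactor_mem_Icc (hμ : μ ∈ stdSimplex ℝ M.Transition) :
    1 - M.contractionFactor μ ∈ Set.Icc 0 (M.minStateActionProb μ) := by
  have hp := (minStateActionProb_mem_Icc hμ).1
  rw [one_sub_contractionFactor]
  exact ⟨mul_nonneg (sub_nonneg.2 M.γ_lt_one.le) hp,
    mul_le_of_le_one_left hp (sub_le_self 1 M.γ_pos.le)⟩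

end Minimum

variable {μ : M.Transition → ℝ} {α p : ℝ} {t n : ℕ}

theorem pathExp_visitDeviation_le_one_sixth (π : Policy S A) (hμ : μ ∈ stdSimplex ℝ M.Transition)
    (hmix : ∀ y, tvDist ((M.dataMatrix π ^ t) y) μ ≤ α) (hα0 : 0 < α) (ht : 1 ≤ t) (hp0 : 0 < p)
    (hp : ∀ z, p ≤ M.stateActionLaw μ z) (hαt : α * t ≤ p ^ 2 / 10000) (htn : t < n)
    (hm : 99 / 1000 ≤ α * (n - t : ℕ)) (y : M.Transition) :
    pathExp (M.dataMatrix π) n (visitDeviation (M.stateActionLaw μ) t n) y ≤ 1 / 6 := by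
  have hp1 : p ≤ 1 := (hp (y.state, y.action)).trans (stateActionLaw_le_one hμ _)
  have hα : α ≤ p ^ 2 / 10000 := (le_mul_of_one_le_right hα0.le (Nat.one_le_cast.2 ht)).trans hαt
  have hm0 : (0 : ℝ) < (n - t : ℕ) := Nat.cast_pos.2 (Nat.sub_pos_of_lt htn)
  have hratio : (t : ℝ) / (n - t : ℕ) ≤ p ^ 2 / 990 := by
    rw [div_le_iff₀ hm0]
    refine le_of_mul_le_mul_left ?_ hα0
    linarith [mul_le_mul_of_nonneg_left hm (sq_nonneg p)]
  refine (pathExp_visitDeviation_le π hμ hmix hp0 hp (by nlinarith) htn y).trans ?_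
  rw [div_mul_eq_mul_div, div_le_iff₀ (by positivity)]
  linarith [sq_nonneg p]

theorem pathExp_blockFactor_le_pow (π : Policy S A) {ν : S × A → ℝ} {g : ℝ} (hα0 : 0 ≤ α)
    (hg0 : 0 ≤ g) (hg : g * α ≤ 4) {y : M.Transition}
    (hD : pathExp (M.dataMatrix π) n (visitDeviation ν t n) y ≤ 1 / 6) :
    pathExp (M.dataMatrix π) n (blockFactor (3 / 5 * (g * (α * n))) ν t n) y
      ≤ (1 - g * α / 2) ^ n := by
  have hbernoulli := one_add_mul_sub_le_pow (show -1 ≤ 1 - g * α / 2 by linarith) n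
  have hκ : 0 ≤ g * (α * n) := by positivity
  rw [pathExp_blockFactor]
  nlinarith

end Rate

end MDP

theorem proposition1_general {S A : Type*} [Fintype S] [Fintype A] [DecidableEq S] [DecidableEq A]
    [Nonempty S] [Nonempty A] (M : MDP S A) (π : Policy S A) {μ ι : M.Transition → ℝ} {α : ℝ}
    {Ω : Type*} [MeasurableSpace Ω] {Pr : Measure Ω}
    {x : ℕ → Ω → M.Transition} {q₁ q₂ : Ω → S × A → ℝ}
    (hμ : μ ∈ stdSimplex ℝ M.Transition) (hx : ∀ k, Measurable (x k))
    (hM : IsMarkovChain Pr (M.dataMatrix π) ι x) (hq₁ : Measurable q₁) (hq₂ : Measurable q₂)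
    (hind : ∀ y : M.Transition,
      IndepFun (fun ω => (q₁ ω, q₂ ω)) (fun ω k => x (k + 1) ω) (Pr[|x 0 ⁻¹' {y}]))
    (hα0 : 0 < α) {t : ℕ} (ht : 1 ≤ t)
    (hmix : ∀ y, tvDist ((M.dataMatrix π ^ t) y) μ ≤ α)
    (hαt : α * t ≤ M.minStateActionProb μ ^ 2 / 10000) (k : ℕ) :
    ∫⁻ ω, ‖M.qLearning α (fun j => x j ω) (q₁ ω) k
        - M.qLearning α (fun j => x j ω) (q₂ ω) k‖ₑ ^ 2 ∂Pr
      ≤ 2 * (∫⁻ ω, ‖q₁ ω - q₂ ω‖ₑ ^ 2 ∂Pr) *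
        ENNReal.ofReal ((1 - (1 - M.contractionFactor μ) * α / 2) ^ k) := by
  obtain ⟨hp0, hp1⟩ := MDP.minStateActionProb_mem_Icc hμ
  have hp := MDP.minStateActionProb_le (μ := μ)
  obtain ⟨hg0, hgp⟩ := MDP.one_sub_contractionFactor_mem_Icc hμ
  have hg := MDP.one_sub_contractionFactor (μ := μ)
  set p := M.minStateActionProb μ
  set g := 1 - M.contractionFactor μ
  have hp_pos : 0 < p := hp0.lt_of_ne' fun h => by
    have : 0 < α * t := mul_pos hα0 (Nat.cast_pos.2 ht)
    rw [h] at hαt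
    linarith
  have hp2 : p ^ 2 ≤ 1 := pow_le_one₀ hp0 hp1
  obtain ⟨n, htn, hn, ht_small, hm⟩ := exists_block_length hα0 ht (by linarith)
  have hα1 : α ≤ 1 := by linarith [le_mul_of_one_le_right hα0.le (Nat.one_le_cast.2 ht)]
  have hgα : g * α ≤ 1 := mul_le_one₀ (hgp.trans hp1) hα0.le hα1
  have hgαn : g * (α * n) ≤ 11 / 100 :=
    (mul_le_of_le_one_left (by positivity) (hgp.trans hp1)).trans hn
  have hcontraction : ∀ z, ∀ N : ℕ, 3 / 4 * ((n - t : ℕ) * M.stateActionLaw μ z) ≤ N →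
      3 / 5 * (g * (α * n)) ≤ (1 - M.γ) * (1 - (1 - α) ^ N) := fun z N hN => by
    rw [hg, mul_assoc, mul_left_comm]
    exact mul_le_mul_of_nonneg_left (mul_le_one_sub_pow_of_le_visits hα0.le hα1 hp0 hp1 hn
      ht_small htn.le (hp z) hN) (sub_nonneg.2 M.γ_lt_one.le)
  have hmean := fun y => MDP.pathExp_blockFactor_le_pow (ν := M.stateActionLaw μ) π hα0.le hg0
    (by linarith) (MDP.pathExp_visitDeviation_le_one_sixth π hμ hmix hα0 ht hp_pos hp hαt htn hm y)
  have hbernoulli := one_add_mul_sub_le_pow (show -1 ≤ 1 - g * α / 2 by linarith) n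
  calc _ ≤ _ := MDP.lintegral_qLearning_sub_sq_le π hα0.le hα1 (by positivity) (by linarith)
          (fun z => hp_pos.trans_le (hp z)) htn hcontraction hmean hx hM hq₁ hq₂ hind
          (Nat.div_mul_le_self k n)
    _ ≤ (∫⁻ ω, ‖q₁ ω - q₂ ω‖ₑ ^ 2 ∂Pr) * ENNReal.ofReal (2 * (1 - g * α / 2) ^ k) := by
        gcongr
        exact pow_pow_div_le (by linarith) (sub_le_self 1 (by positivity)) (by omega)
          (by linarith) k
    _ = _ := by
        rw [ENNReal.ofReal_mul zero_le_two, ENNReal.ofReal_ofNat]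
        ring

theorem tvDist_pow_mixingTime_le {X : Type*} [Fintype X] [DecidableEq X] {P : Matrix X X ℝ}
    {μ : X → ℝ} {δ : ℝ} (h : 1 ≤ mixingTime P μ δ) (y : X) :
    tvDist ((P ^ mixingTime P μ δ) y) μ ≤ δ :=
  Nat.sInf_mem (s := {k | ∀ x, tvDist ((P ^ k) x) μ ≤ δ}) (Nat.nonempty_of_pos_sInf h) y

-- The divisor `log N` is `0` for `N = 1`, so positivity of `u` is what forces `2 ≤ N`.
theorem le_two_mul_of_le_div_log {u v : ℝ} {N : ℕ} (hu : 0 < u) (hN : 0 < N) (hv : 0 ≤ v)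
    (h : u ≤ v / Real.log N) : u ≤ 2 * v := by
  have hN2 : 2 ≤ N := by
    by_contra! hlt
    obtain rfl : N = 1 := by omega
    rw [Nat.cast_one, Real.log_one, div_zero] at h
    exact hu.not_ge h
  have hlog : 1 / 2 ≤ Real.log N := by
    linarith [Real.log_two_gt_d9, Real.log_le_log two_pos (Nat.ofNat_le_cast.2 hN2)]
  calc u ≤ v / Real.log N := h
    _ ≤ v / (1 / 2) := div_le_div_of_nonneg_left hv one_half_pos hlog
    _ = 2 * v := by ring

theorem proposition1 :
    ∃ c₀ : ℝ, 0 < c₀ ∧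
      ∀ (S A : Type*) [Fintype S] [Fintype A] [DecidableEq S] [DecidableEq A]
        [Nonempty S] [Nonempty A] (M : MDP S A) (π : Policy S A)
        (μ : M.Transition → ℝ) (α : ℝ)
        (Ω : Type*) [MeasurableSpace Ω] (Pr : Measure Ω) [IsProbabilityMeasure Pr]
        (x : ℕ → Ω → M.Transition) (q₁ q₂ : Ω → S × A → ℝ),
        -- the data stream is an irreducible, aperiodic, stationary Markov chain
        (M.dataMatrix π).IsIrreducible →
        IsAperiodic (M.dataMatrix π) →
        IsStationaryDist (M.dataMatrix π) μ →
        (∀ k, Measurable (x k)) →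
        IsMarkovChain Pr (M.dataMatrix π) μ x →
        -- given `x₀`, the initial iterates are independent of `x₁, x₂, …`
        Measurable q₁ →
        Measurable q₂ →
        (∀ y : M.Transition,
          IndepFun (fun ω => (q₁ ω, q₂ ω)) (fun ω k => x (k + 1) ω) (Pr[|x 0 ⁻¹' {y}])) →
        -- the stepsize
        0 < α →
        1 ≤ mixingTime (M.dataMatrix π) μ α →
        α * mixingTime (M.dataMatrix π) μ α ≤
          c₀ * (1 - M.contractionFactor μ) ^ 2 /
            Real.log (Fintype.card S * Fintype.card A) →
        ∀ k : ℕ, mixingTime (M.dataMatrix π) μ α ≤ k →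
          ∫⁻ ω, ‖M.qLearning α (fun j => x j ω) (q₁ ω) k
              - M.qLearning α (fun j => x j ω) (q₂ ω) k‖ₑ ^ 2 ∂Pr ≤
            12 * (∫⁻ ω, ‖q₁ ω - q₂ ω‖ₑ ^ 2 ∂Pr) *
              ENNReal.ofReal ((1 - (1 - M.contractionFactor μ) * α / 2) ^
                (k - mixingTime (M.dataMatrix π) μ α)) := by
  refine ⟨1 / 20000, by norm_num, ?_⟩
  intro S A _ _ _ _ _ _ M π μ α Ω _ Pr _ x q₁ q₂ _ _ hstat hx hM hq₁ hq₂ hind hα ht hαt k hk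
  obtain ⟨hβ, hβp⟩ := MDP.one_sub_contractionFactor_mem_Icc hstat.1
  have hβ1 := hβp.trans (MDP.minStateActionProb_mem_Icc hstat.1).2
  have hstep : α * mixingTime (M.dataMatrix π) μ α ≤ M.minStateActionProb μ ^ 2 / 10000 := by
    rw [← Nat.cast_mul] at hαt
    have := le_two_mul_of_le_div_log (mul_pos hα (Nat.cast_pos.2 ht))
      (Nat.mul_pos Fintype.card_pos Fintype.card_pos) (by positivity) hαt
    linarith [pow_le_pow_left₀ hβ hβp 2]
  have hα1 : α ≤ 1 := by
    have := le_mul_of_one_le_right hα.le (Nat.one_le_cast.2 ht)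
    nlinarith [(MDP.minStateActionProb_mem_Icc hstat.1).2, hβ.trans hβp]
  refine (proposition1_general M π hstat.1 hx hM hq₁ hq₂ hind hα ht
    (tvDist_pow_mixingTime_le ht) hstep k).trans ?_
  gcongr ?_ * _ * ENNReal.ofReal ?_
  · norm_num
  · exact pow_le_pow_of_le_one (by nlinarith) (sub_le_self 1 (by positivity)) (k.sub_le _)
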